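/- Let $A$ be a $W^*$-algebra and $(E,A)$ a $W^*$-correspondence: a selfdual right Hilbert $C^*$-module $E$ over $A$ with a unital normal $*$-homomorphism $\varphi$ from $A$ to the algebra $\mathcal L(E)$ of adjointable operators. Let $\sigma:A\to B(H)$ be a unital normal $*$-representation, and let $E\otimes_\sigma H$ be the Hilbert space completion of $E\otimes H$ for $\langle x\otimes h,y\otimes k\rangle=\langle h,\sigma(\langle x,y\rangle)k\rangle$. Let $(E^\sigma)^*$ be the space of bounded operators $\eta^*:E\otimes_\sigma H\to H$ with $\eta^*(\varphi(a)\otimes I_H)=\sigma(a)\eta^*$ for all $a\in A$, let $E^\sigma$ be the space of their adjoints $\eta$, and let $\mathbb D((E^\sigma)^*)$ be the open unit ball of $(E^\sigma)^*$. The Hardy algebra $H^\infty(E)$ is the ultraweakly closed algebra generated by the operators $\varphi_\infty(a)$ ($a\in A$) and the creation operators $T_x$ ($x\in E$) on the Fock space of $E$. $\mathrm{Aut}(H^\infty(E))$ is the group of its completely isometric, $w^*$-homeomorphic automorphisms that fix every $\varphi_\infty(a)$. For $\eta^*\in\mathbb D((E^\sigma)^*)$ and $X\in H^\infty(E)$ put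 $\widehat X(\eta^*)=(\sigma\times\eta^*)(X)$, where $\sigma\times\eta^*$ is the ultraweakly continuous completely contractive representation of $H^\infty(E)$ on $H$ with $\varphi_\infty(a)\mapsto\sigma(a)$ and $T_x\mapsto\eta^*(x\otimes\cdot)$. A biholomorphic self-map $g$ of $\mathbb D((E^\sigma)^*)$ implements $\alpha\in\mathrm{Aut}(H^\infty(E))$ if $\widehat{\alpha(X)}(\eta^*)=\widehat X(g(\eta^*))$ for all $X\in H^\infty(E)$ and $\eta^*\in\mathbb D((E^\sigma)^*)$. Let $\mathbb P$ be the set of pairs $(U,\eta^*)$, with $U$ an invertible element of the commutant $\sigma(A)'$ and $\eta^*\in(E^\sigma)^*$, modulo the relation $(U,\eta^*)\sim(CU,C\eta^*)$ for invertible $C\in\sigma(A)'$. Write $[U\ \ \eta^*]$ for the class of $(U,\eta^*)$, which is also regarded as a $1\times2$ block matrix. For $\gamma\in E^\sigma$ with $\|\gamma\|<1$ let $\Delta_\gamma=(I_H-\gamma^*\gamma)^{1/2}$, $\Delta_{\gamma^*}=(I_{E\otimes_\sigma H}-\gamma\gamma^*)^{1/2}$ and $$g_\gamma(\eta^*)=\Delta_\gamma(I_H-\eta^*\gamma)^{-1}(\gamma^*-\eta^*)\Delta_{\gamma^*}^{-1}.$$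 **Theorem.** Suppose that a biholomorphic self-map $g$ of $\mathbb D((E^\sigma)^*)$ implements some $\alpha\in\mathrm{Aut}(H^\infty(E))$ and has the form $g(\eta^*)=g_\gamma(\eta^*)(u\otimes I_H)$ for all $\eta^*\in\mathbb D((E^\sigma)^*)$, with $\gamma\in E^\sigma$, $\|\gamma\|<1$, and $u\in\mathcal L(E)$ unitary. Put $$T=\begin{pmatrix}\Delta_\gamma^{-1}&\gamma^*\Delta_{\gamma^*}^{-1}(u\otimes I_H)\\-\gamma\Delta_\gamma^{-1}&-\Delta_{\gamma^*}^{-1}(u\otimes I_H)\end{pmatrix}.$$ Then for every $\eta^*\in\mathbb D((E^\sigma)^*)$ the row $(I_H\ \ \eta^*)\,T$ consists of an invertible element of $\sigma(A)'$ and an element of $(E^\sigma)^*$, and in $\mathbb P$ $$[I_H\ \ \eta^*]\,T=[I_H\ \ g(\eta^*)].$$ Moreover, this does not depend on the representative: for every $(U,\xi^*)\sim(I_H,\eta^*)$ the row $(U\ \ \xi^*)\,T$ again consists of an invertible element of $\sigma(A)'$ and an element of $(E^\sigma)^*$, and its class in $\mathbb P$ is $[I_H\ \ g(\eta^*)]$.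 -/

import Mathlib

open scoped TensorProduct InnerProductSpace ComplexOrder
open MulOpposite (op)

universe u v w

noncomputable section

namespace Hardy

/-- A right Hilbert C⋆-module over `A`, i.e. a right `A`-module (a module over `Aᵐᵒᵖ`, `op a • x`
being `x · a`) with an `A`-valued inner product, linear in the second variable, which induces the
norm of `E`. (Mathlib's `CStarModule` is the left-module variant.) -/
class RightCStarModule (A E : Type*) [CStarAlgebra A] [PartialOrder A] [StarOrderedRing A]
    [NormedAddCommGroup E] [NormedSpace ℂ E] [CompleteSpace E] [Module Aᵐᵒᵖ E] where
  ip : E → E → A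
  ip_add_right : ∀ x y z, ip x (y + z) = ip x y + ip x z
  ip_smul_right : ∀ (c : ℂ) x y, ip x (c • y) = c • ip x y
  ip_op_smul_right : ∀ (a : A) x y, ip x (op a • y) = ip x y * a
  star_ip : ∀ x y, star (ip x y) = ip y x
  ip_self_nonneg : ∀ x, 0 ≤ ip x x
  norm_eq_sqrt : ∀ x, ‖x‖ = √‖ip x x‖

open RightCStarModule

section Module

variable {A E : Type*} [CStarAlgebra A] [PartialOrder A] [StarOrderedRing A]
    [NormedAddCommGroup E] [NormedSpace ℂ E] [CompleteSpace E] [Module Aᵐᵒᵖ E]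
    [RightCStarModule A E]

lemma ip_add_left (x y z : E) : (ip (x + y) z : A) = ip x z + ip y z := by
  rw [← star_ip, ip_add_right, star_add, star_ip, star_ip]

lemma ip_smul_left (c : ℂ) (x y : E) : (ip (c • x) y : A) = star c • ip x y := by
  rw [← star_ip, ip_smul_right, star_smul, star_ip]

lemma ip_op_smul_left (a : A) (x y : E) : ip (op a • x) y = star a * ip x y := by
  rw [← star_ip, ip_op_smul_right, star_mul, star_ip]

lemma ip_sum_right {ι : Type*} (s : Finset ι) (x : E) (y : ι → E) :
    (ip x (∑ i ∈ s, y i) : A) = ∑ i ∈ s, ip x (y i) :=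
  map_sum (AddMonoidHom.mk' (fun z => (ip x z : A)) (ip_add_right x)) y s

lemma ip_sum_left {ι : Type*} (s : Finset ι) (x : ι → E) (y : E) :
    (ip (∑ i ∈ s, x i) y : A) = ∑ i ∈ s, ip (x i) y :=
  map_sum (AddMonoidHom.mk' (fun z => (ip z y : A)) (fun a b => ip_add_left a b y)) x s

lemma norm_sq_eq (x : E) : ‖x‖ ^ 2 = ‖(ip x x : A)‖ := by
  rw [norm_eq_sqrt (A := A) x, Real.sq_sqrt (norm_nonneg _)]

/-- A bounded operator on `E` that commutes with the right action of `A`. -/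
def IsModuleMap (A : Type*) {E : Type*} [CStarAlgebra A] [NormedAddCommGroup E] [NormedSpace ℂ E]
    [Module Aᵐᵒᵖ E] (T : E →L[ℂ] E) : Prop :=
  ∀ (x : E) (a : A), T (op a • x) = op a • T x

lemma ip_map_le (T : E →L[ℂ] E) (hT : IsModuleMap A T) (y : E) :
    (ip (T y) (T y) : A) ≤ algebraMap ℝ A (‖T‖ ^ 2) * ip y y := by
  set p : A := ip y y with hp
  set q : A := ip (T y) (T y) with hq
  have hp0 : 0 ≤ p := ip_self_nonneg y
  have hq0 : 0 ≤ q := ip_self_nonneg _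
  have key : ∀ ε : ℝ, 0 < ε → q ≤ algebraMap ℝ A (‖T‖ ^ 2) * (p + algebraMap ℝ A ε) := by
    intro ε hε
    have hε' : IsStrictlyPositive (algebraMap ℝ A ε) := by
      rw [IsStrictlyPositive.iff_of_unital]
      exact ⟨by exact algebraMap_nonneg A hε.le, (IsUnit.mk0 ε hε.ne').map (algebraMap ℝ A)⟩
    have hc : IsStrictlyPositive (p + algebraMap ℝ A ε) := hε'.nonneg_add hp0
    set c := p + algebraMap ℝ A ε with hcdef
    have hs : IsUnit (CFC.sqrt c) := CFC.isUnit_sqrt_iff_isStrictlyPositive.mpr hc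
    obtain ⟨s, hs⟩ := hs
    have hsa : IsSelfAdjoint (s : A) := by
      rw [hs]; exact (CFC.sqrt_nonneg c).isSelfAdjoint
    have hss : (s : A) * s = c := by rw [hs]; exact CFC.sqrt_mul_sqrt_self c hc.nonneg
    set b : A := ((s⁻¹ : Aˣ) : A) with hb
    have hbs : b * s = 1 := s.inv_mul
    have hsb : (s : A) * b = 1 := s.mul_inv
    have hba : star b = b := by
      have h1 : star b * s = 1 := by
        have := congrArg star hsb
        simpa [hsa.star_eq] using this
      calc star b = star b * (s * b) := by rw [hsb, mul_one]
        _ = b := by rw [← mul_assoc, h1, one_mul]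
    have hbcb : b * c * b = 1 := by rw [← hss]; simp [hbs, hsb, ← mul_assoc]
    have hbpb : b * p * b ≤ 1 := by
      rw [← hbcb]
      have := star_left_conjugate_le_conjugate (a := p) (b := c)
        (by rw [hcdef]; exact le_add_of_nonneg_right hε'.nonneg) b
      simpa [hba] using this
    have hyb : (ip (op b • y) (op b • y) : A) = b * p * b := by
      rw [ip_op_smul_left, ip_op_smul_right, hba, mul_assoc]
    have hTb : (ip (T (op b • y)) (T (op b • y)) : A) = b * q * b := by
      rw [hT, ip_op_smul_left, ip_op_smul_right, hba, mul_assoc]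
    have hny : ‖op b • y‖ ≤ 1 := by
      have h0 : 0 ≤ b * p * b := by rw [← hyb]; exact ip_self_nonneg _
      have : ‖op b • y‖ ^ 2 ≤ 1 := by
        rw [norm_sq_eq (A := A), hyb]
        exact (CStarAlgebra.norm_le_one_iff_of_nonneg _ h0).2 hbpb
      nlinarith [norm_nonneg (op b • y)]
    have hnT : ‖b * q * b‖ ≤ ‖T‖ ^ 2 := by
      rw [← hTb, ← norm_sq_eq]
      have : ‖T (op b • y)‖ ≤ ‖T‖ := (T.le_opNorm _).trans (by nlinarith [norm_nonneg T])
      gcongr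
    have h0 : 0 ≤ b * q * b := by rw [← hTb]; exact ip_self_nonneg _
    have h1 := (CStarAlgebra.norm_le_iff_le_algebraMap _ (by positivity) h0).1 hnT
    have h2 := star_left_conjugate_le_conjugate h1 (s : A)
    rw [hsa.star_eq] at h2
    have h3 : (s : A) * (b * q * b) * s = q := by
      calc (s : A) * (b * q * b) * s = (s * b) * q * (b * s) := by simp only [mul_assoc]
        _ = q := by rw [hsb, hbs, one_mul, mul_one]
    rw [h3, ← Algebra.commutes, mul_assoc, hss] at h2
    exact h2
  have hlim : Filter.Tendsto (fun ε : ℝ => algebraMap ℝ A (‖T‖ ^ 2) * (p + algebraMap ℝ A ε))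
      (nhdsWithin 0 (Set.Ioi 0)) (nhds (algebraMap ℝ A (‖T‖ ^ 2) * (p + algebraMap ℝ A 0))) := by
    apply Filter.Tendsto.mono_left _ nhdsWithin_le_nhds
    apply Continuous.tendsto
    have := continuous_algebraMap ℝ A
    fun_prop
  rw [map_zero, add_zero] at hlim
  exact ge_of_tendsto hlim (by filter_upwards [self_mem_nhdsWithin] with ε hε using key ε hε)

end Module

section Positivity

variable {A H : Type*} [CStarAlgebra A] [PartialOrder A] [StarOrderedRing A]
  [NormedAddCommGroup H] [InnerProductSpace ℂ H] [CompleteSpace H]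

lemma exists_neg {B : Type*} [CStarAlgebra B] [PartialOrder B] [StarOrderedRing B] (G : B)
    (hG : IsSelfAdjoint G) :
    ∃ N C : B, N = star C * C ∧ star N = N ∧ N * G * N = -(N * N * N) ∧
      (N * N * N = 0 → 0 ≤ G) := by
  have hn : 0 ≤ G⁻ := CFC.negPart_nonneg G
  have hna : star G⁻ = G⁻ := hn.isSelfAdjoint.star_eq
  obtain ⟨C, hC⟩ := CStarAlgebra.nonneg_iff_eq_star_mul_self.1 hn
  have hG' := CFC.posPart_sub_negPart G hG
  refine ⟨G⁻, C, hC, hna, ?_, ?_⟩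
  · have h1 : G⁻ * G = - (G⁻ * G⁻) := by
      nth_rewrite 2 [← hG']
      rw [mul_sub, CFC.negPart_mul_posPart, zero_sub]
    rw [h1, neg_mul]
  · intro h
    have h2 : G⁻ * G⁻ = 0 := by
      rw [← CStarRing.star_mul_self_eq_zero_iff, star_mul, hna, ← mul_assoc, h, zero_mul]
    have h3 : G⁻ = 0 := by
      rw [← CStarRing.star_mul_self_eq_zero_iff, hna, h2]
    rw [← hG', h3, sub_zero]
    exact CFC.posPart_nonneg G

lemma exists_sq {B : Type*} [CStarAlgebra B] [PartialOrder B] [StarOrderedRing B] (G : B)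
    (hG : 0 ≤ G) : ∃ C, G = star C * C := CStarAlgebra.nonneg_iff_eq_star_mul_self.1 hG

lemma matrix_nonneg {n : ℕ} (G : CStarMatrix (Fin n) (Fin n) A) (hG : IsSelfAdjoint G)
    (h : ∀ b : Fin n → A, 0 ≤ ∑ i, ∑ j, star (b i) * G i j * b j) : 0 ≤ G := by
  obtain ⟨N, C, hC, hN, h1, h2⟩ := exists_neg G hG
  apply h2
  have hD : N * N * N = star (C * N) * (C * N) := by
    rw [star_mul, hN]
    nth_rewrite 2 [hC]
    simp only [mul_assoc]
  have hz : ∀ l k, (C * N) l k = 0 := by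
    intro l k
    have e1 : (N * G * N) k k = ∑ i, ∑ j, star (N i k) * G i j * N j k := by
      have : ∀ i, N k i = star (N i k) := fun i => by
        conv_lhs => rw [← hN, CStarMatrix.star_apply]
      simp only [CStarMatrix.mul_apply, Finset.sum_mul, this]
      rw [Finset.sum_comm]
    have e2 : (N * N * N) k k = ∑ i, star ((C * N) i k) * (C * N) i k := by
      rw [hD, CStarMatrix.mul_apply]
      simp only [CStarMatrix.star_apply]
    have e3 : (N * G * N) k k = - (N * N * N) k k := by rw [h1]; rfl
    have e4 := h (fun i => N i k)
    rw [← e1, e3, e2] at e4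
    have e5 : ∀ i ∈ Finset.univ, 0 ≤ star ((C * N) i k) * (C * N) i k :=
      fun i _ => star_mul_self_nonneg _
    have e6 := le_antisymm (neg_nonneg.1 e4) (Finset.sum_nonneg e5)
    have e7 := (Finset.sum_eq_zero_iff_of_nonneg e5).1 e6 l (Finset.mem_univ _)
    exact (CStarRing.star_mul_self_eq_zero_iff _).1 e7
  have : C * N = 0 := by ext l k; exact hz l k
  rw [hD, this, mul_zero]

lemma inner_star_mul (σ : A →⋆ₐ[ℂ] (H →L[ℂ] H)) (a b : A) (x y : H) :
    ⟪x, σ (star a * b) y⟫_ℂ = ⟪σ a x, σ b y⟫_ℂ := by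
  have h1 : σ (star a * b) = σ (star a) * σ b := map_mul σ _ _
  have h2 : σ (star a) = ContinuousLinearMap.adjoint (σ a) := map_star σ a
  rw [h1, h2, mul_apply_eq_comp]
  exact ContinuousLinearMap.adjoint_inner_right _ _ _

lemma gram_nonneg (σ : A →⋆ₐ[ℂ] (H →L[ℂ] H)) {n : ℕ} (C : Fin n → Fin n → A) (k : Fin n → H) :
    0 ≤ ∑ i, ∑ j, ⟪k i, σ (∑ l, star (C l i) * C l j) (k j)⟫_ℂ := by
  have e : ∀ i j, ⟪k i, σ (∑ l, star (C l i) * C l j) (k j)⟫_ℂ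
      = ∑ l, ⟪σ (C l i) (k i), σ (C l j) (k j)⟫_ℂ := by
    intro i j
    rw [map_sum σ, sum_apply, inner_sum]
    exact Finset.sum_congr rfl fun l _ => inner_star_mul σ _ _ _ _
  have e2 : ∀ l, ⟪∑ i, σ (C l i) (k i), ∑ i, σ (C l i) (k i)⟫_ℂ
      = ∑ i, ∑ j, ⟪σ (C l i) (k i), σ (C l j) (k j)⟫_ℂ := by
    intro l
    rw [sum_inner]
    exact Finset.sum_congr rfl fun i _ => inner_sum _ _ _
  have e3 : ∑ i, ∑ j, ⟪k i, σ (∑ l, star (C l i) * C l j) (k j)⟫_ℂ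
      = ∑ l, ⟪∑ i, σ (C l i) (k i), ∑ i, σ (C l i) (k i)⟫_ℂ := by
    simp_rw [e, e2]
    rw [Finset.sum_comm (s := Finset.univ (α := Fin n)) (f := fun l i =>
      ∑ j, ⟪σ (C l i) (k i), σ (C l j) (k j)⟫_ℂ)]
    exact Finset.sum_congr rfl fun i _ => Finset.sum_comm
  rw [e3]
  exact Finset.sum_nonneg fun l _ => by
    rw [inner_self_eq_norm_sq_to_K]
    rw [← RCLike.ofReal_pow]
    exact Complex.zero_le_real.2 (sq_nonneg ‖∑ i, σ (C l i) (k i)‖)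

lemma kernel_nonneg (σ : A →⋆ₐ[ℂ] (H →L[ℂ] H)) {n : ℕ} (G : Fin n → Fin n → A)
    (hG : ∀ i j, star (G i j) = G j i)
    (h : ∀ b : Fin n → A, 0 ≤ ∑ i, ∑ j, star (b i) * G i j * b j) (k : Fin n → H) :
    0 ≤ ∑ i, ∑ j, ⟪k i, σ (G i j) (k j)⟫_ℂ := by
  have h0 : 0 ≤ CStarMatrix.ofMatrix (Matrix.of G) :=
    matrix_nonneg _ (by ext i j; exact hG j i) h
  obtain ⟨C, hC⟩ := exists_sq _ h0
  have hC' : ∀ i j, G i j = ∑ l, star (C l i) * C l j := by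
    intro i j
    have : G i j = (star C * C) i j := by rw [← hC]; rfl
    rw [this, CStarMatrix.mul_apply]
    simp only [CStarMatrix.star_apply]
  simp only [hC']
  exact gram_nonneg σ (fun i j => C i j) k

end Positivity

section Interior

variable {A E H : Type*} [CStarAlgebra A] [PartialOrder A] [StarOrderedRing A]
  [NormedAddCommGroup E] [NormedSpace ℂ E] [CompleteSpace E] [Module Aᵐᵒᵖ E]
  [RightCStarModule A E]
  [NormedAddCommGroup H] [InnerProductSpace ℂ H] [CompleteSpace H]

/-- The algebraic tensor product of `E` and `H`, on which the representation `σ` induces a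
positive semidefinite inner product. -/
def PreTensor (E : Type*) {A H : Type*} [CStarAlgebra A] [NormedAddCommGroup E] [NormedSpace ℂ E]
    [NormedAddCommGroup H] [InnerProductSpace ℂ H] [CompleteSpace H]
    (_σ : A →⋆ₐ[ℂ] (H →L[ℂ] H)) : Type _ := E ⊗[ℂ] H

variable (E) in
/-- The form `⟨x ⊗ h, y ⊗ k⟩ = ⟨h, σ(⟨x, y⟩) k⟩` on the algebraic tensor product. -/
def tensorForm (σ : A →⋆ₐ[ℂ] (H →L[ℂ] H)) : E ⊗[ℂ] H →ₗ⋆[ℂ] E ⊗[ℂ] H →ₗ[ℂ] ℂ :=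
  TensorProduct.lift <| LinearMap.mk₂'ₛₗ (starRingEnd ℂ) (starRingEnd ℂ)
    (fun x h => TensorProduct.lift <| LinearMap.mk₂ ℂ (fun y k => ⟪h, σ (ip x y) k⟫_ℂ)
      (fun y y' k => by simp [ip_add_right])
      (fun c y k => by simp [ip_smul_right])
      (fun y k k' => by simp)
      (fun c y k => by simp))
    (fun x x' h => by ext y k; simp [ip_add_left])
    (fun c x h => by ext y k; simp [ip_smul_left])
    (fun x h h' => by ext y k; simp)
    (fun c x h => by ext y k; simp [mul_comm])

@[simp] lemma tensorForm_tmul (σ : A →⋆ₐ[ℂ] (H →L[ℂ] H)) (x y : E) (h k : H) :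
    tensorForm E σ (x ⊗ₜ h) (y ⊗ₜ k) = ⟪h, σ (ip x y) k⟫_ℂ := rfl

lemma exists_fin_sum (v : E ⊗[ℂ] H) :
    ∃ (n : ℕ) (x : Fin n → E) (h : Fin n → H), v = ∑ i, x i ⊗ₜ[ℂ] h i := by
  obtain ⟨n, x, h, e⟩ := TensorProduct.exists_sum_tmul_eq v
  exact ⟨n, x, h, e⟩

lemma tensorForm_sum (σ : A →⋆ₐ[ℂ] (H →L[ℂ] H)) {n : ℕ} (x : Fin n → E) (h : Fin n → H) :
    tensorForm E σ (∑ i, x i ⊗ₜ h i) (∑ i, x i ⊗ₜ h i)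
      = ∑ i, ∑ j, ⟪h i, σ (ip (x i) (x j)) (h j)⟫_ℂ := by
  simp only [map_sum, LinearMap.sum_apply, tensorForm_tmul]
  exact Finset.sum_comm

lemma tensorForm_symm (σ : A →⋆ₐ[ℂ] (H →L[ℂ] H)) (v w : E ⊗[ℂ] H) :
    starRingEnd ℂ (tensorForm E σ w v) = tensorForm E σ v w := by
  induction v with
  | zero => simp
  | add v v' hv hv' => simp [hv, hv']
  | tmul x h =>
    induction w with
    | zero => simp
    | add w w' hw hw' => simp [hw, hw']
    | tmul y k =>
      rw [tensorForm_tmul, tensorForm_tmul, inner_conj_symm, ← star_ip y x, map_star σ,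
        ContinuousLinearMap.star_eq_adjoint, ContinuousLinearMap.adjoint_inner_right]

lemma ip_sum_op {n : ℕ} (x : Fin n → E) (b : Fin n → A) :
    ∑ i, ∑ j, star (b i) * ip (x i) (x j) * b j
      = ip (∑ i, op (b i) • x i) (∑ i, op (b i) • x i) := by
  rw [ip_sum_left]
  refine Finset.sum_congr rfl fun i _ => ?_
  rw [ip_sum_right]
  refine Finset.sum_congr rfl fun j _ => ?_
  rw [ip_op_smul_left, ip_op_smul_right, mul_assoc]

lemma tensorForm_nonneg (σ : A →⋆ₐ[ℂ] (H →L[ℂ] H)) (v : E ⊗[ℂ] H) :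
    0 ≤ tensorForm E σ v v := by
  obtain ⟨n, x, h, rfl⟩ := exists_fin_sum v
  rw [tensorForm_sum]
  refine kernel_nonneg σ _ (fun i j => star_ip _ _) (fun b => ?_) h
  rw [ip_sum_op]
  exact ip_self_nonneg _

lemma tensorForm_map_le (σ : A →⋆ₐ[ℂ] (H →L[ℂ] H)) (T : E →L[ℂ] E) (hT : IsModuleMap A T)
    (v : E ⊗[ℂ] H) :
    tensorForm E σ (TensorProduct.map (T : E →ₗ[ℂ] E) LinearMap.id v)
      (TensorProduct.map (T : E →ₗ[ℂ] E) LinearMap.id v) ≤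
      ((‖T‖ ^ 2 : ℝ) : ℂ) * tensorForm E σ v v := by
  obtain ⟨n, x, h, rfl⟩ := exists_fin_sum v
  have e : TensorProduct.map (T : E →ₗ[ℂ] E) LinearMap.id (∑ i, x i ⊗ₜ[ℂ] h i)
      = ∑ i, T (x i) ⊗ₜ[ℂ] h i := by simp
  rw [e, tensorForm_sum, tensorForm_sum, ← sub_nonneg, Finset.mul_sum, ← Finset.sum_sub_distrib]
  have hr : ∀ a : A, algebraMap ℝ A (‖T‖ ^ 2) * a = ((‖T‖ ^ 2 : ℝ) : ℂ) • a := fun a => by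
    rw [← Algebra.smul_def, Complex.coe_smul]
  have := kernel_nonneg σ
    (fun i j => ((‖T‖ ^ 2 : ℝ) : ℂ) • ip (x i) (x j) - ip (T (x i)) (T (x j)))
    (fun i j => by
      rw [star_sub, star_smul, star_ip, star_ip]; simp) (fun b => ?_) h
  · convert this using 2 with i
    rw [Finset.mul_sum, ← Finset.sum_sub_distrib]
    refine Finset.sum_congr rfl fun j _ => ?_
    rw [map_sub σ, map_smul σ, sub_apply, smul_apply, inner_sub_right, inner_smul_right]
  · have h1 := ip_sum_op x b
    have h2 := ip_sum_op (fun i => T (x i)) b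
    have h3 : ∑ i, op (b i) • T (x i) = T (∑ i, op (b i) • x i) := by
      rw [map_sum]; exact Finset.sum_congr rfl fun i _ => (hT _ _).symm
    rw [h3] at h2
    have h4 := ip_map_le T hT (∑ i, op (b i) • x i)
    rw [hr, ← h1, ← h2, ← sub_nonneg] at h4
    convert h4 using 1
    simp only [mul_sub, sub_mul, Finset.sum_sub_distrib, Finset.smul_sum, mul_smul_comm,
      smul_mul_assoc]

section
variable (σ : A →⋆ₐ[ℂ] (H →L[ℂ] H))

instance : AddCommGroup (PreTensor E σ) := inferInstanceAs (AddCommGroup (E ⊗[ℂ] H))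
instance : Module ℂ (PreTensor E σ) := inferInstanceAs (Module ℂ (E ⊗[ℂ] H))

@[reducible] def preCore : PreInnerProductSpace.Core ℂ (PreTensor E σ) where
  inner v w := tensorForm E σ v w
  conj_inner_symm v w := tensorForm_symm σ v w
  re_inner_nonneg v := (Complex.le_def.1 (tensorForm_nonneg σ v)).1
  add_left u v w := by exact LinearMap.map_add₂ _ _ _ _
  smul_left u v c := by exact LinearMap.map_smulₛₗ₂ _ _ _ _

instance : SeminormedAddCommGroup (PreTensor E σ) :=
  @InnerProductSpace.Core.toSeminormedAddCommGroup ℂ _ _ _ _ (preCore σ)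

instance : InnerProductSpace ℂ (PreTensor E σ) := InnerProductSpace.ofCore (preCore σ)

lemma pre_inner_def (v w : PreTensor E σ) : ⟪v, w⟫_ℂ = tensorForm E σ v w := rfl

variable (E) in
/-- The Hilbert space `E ⊗_σ H`: the Hausdorff completion of `E ⊗ H` for the inner product
`⟨x ⊗ h, y ⊗ k⟩ = ⟨h, σ(⟨x, y⟩) k⟩`. -/
def InteriorTensor : Type _ := UniformSpace.Completion (PreTensor E σ)

instance : NormedAddCommGroup (InteriorTensor E σ) :=
  inferInstanceAs (NormedAddCommGroup (UniformSpace.Completion (PreTensor E σ)))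

instance : InnerProductSpace ℂ (InteriorTensor E σ) :=
  inferInstanceAs (InnerProductSpace ℂ (UniformSpace.Completion (PreTensor E σ)))

instance : CompleteSpace (InteriorTensor E σ) :=
  inferInstanceAs (CompleteSpace (UniformSpace.Completion (PreTensor E σ)))

/-- The elementary tensor `x ⊗ h` in `E ⊗ H`. -/
def preTmul (x : E) (h : H) : PreTensor E σ := (x ⊗ₜ[ℂ] h : E ⊗[ℂ] H)

/-- The elementary tensor `x ⊗ h` in `E ⊗_σ H`. -/
def tmul (x : E) (h : H) : InteriorTensor E σ := (preTmul σ x h : UniformSpace.Completion (PreTensor E σ))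

lemma inner_tmul (x y : E) (h k : H) : ⟪tmul σ x h, tmul σ y k⟫_ℂ = ⟪h, σ (ip x y) k⟫_ℂ := by
  exact UniformSpace.Completion.inner_coe (preTmul σ x h) (preTmul σ y k)

lemma norm_sq_pre (v : PreTensor E σ) : ((‖v‖ ^ 2 : ℝ) : ℂ) = tensorForm E σ v v := by
  rw [← pre_inner_def, inner_self_eq_norm_sq_to_K]; push_cast; rfl

/-- The operator `T ⊗ I_H` on the algebraic tensor product. -/
def preTensorId (T : E →L[ℂ] E) (hT : IsModuleMap A T) : PreTensor E σ →L[ℂ] PreTensor E σ :=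
  LinearMap.mkContinuous
    (show PreTensor E σ →ₗ[ℂ] PreTensor E σ from
      TensorProduct.map (T : E →ₗ[ℂ] E) (LinearMap.id : H →ₗ[ℂ] H)) ‖T‖ (fun v => by
    have h := tensorForm_map_le σ T hT v
    have h1 := norm_sq_pre σ v
    have h2 := norm_sq_pre σ (show PreTensor E σ from
      TensorProduct.map (T : E →ₗ[ℂ] E) (LinearMap.id : H →ₗ[ℂ] H) v)
    erw [← h1, ← h2] at h
    rw [← Complex.ofReal_mul, Complex.real_le_real] at h
    refine le_of_sq_le_sq ?_ (by positivity)
    rw [mul_pow]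
    exact h)

/-- The operator `T ⊗ I_H` on `E ⊗_σ H`, for a bounded module map `T` of `E`. -/
def tensorId (T : E →L[ℂ] E) (hT : IsModuleMap A T) :
    InteriorTensor E σ →L[ℂ] InteriorTensor E σ :=
  show UniformSpace.Completion (PreTensor E σ) →L[ℂ] UniformSpace.Completion (PreTensor E σ) from
    (preTensorId σ T hT).completion

@[simp] lemma tensorId_tmul (T : E →L[ℂ] E) (hT : IsModuleMap A T) (x : E) (h : H) :
    tensorId σ T hT (tmul σ x h) = tmul σ (T x) h := by
  exact ContinuousLinearMap.completion_apply_coe (preTensorId σ T hT) (preTmul σ x h)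

lemma tmul_add_right (x : E) (h k : H) : tmul σ x (h + k) = tmul σ x h + tmul σ x k := by
  have : preTmul σ x (h + k) = preTmul σ x h + preTmul σ x k := TensorProduct.tmul_add _ _ _
  rw [tmul, this]; exact UniformSpace.Completion.coe_add _ _

lemma tmul_smul_right (x : E) (c : ℂ) (h : H) : tmul σ x (c • h) = c • tmul σ x h := by
  have : preTmul σ x (c • h) = c • preTmul σ x h := TensorProduct.tmul_smul _ _ _
  rw [tmul, this]; exact UniformSpace.Completion.coe_smul _ _

lemma tmul_add_left (x y : E) (h : H) : tmul σ (x + y) h = tmul σ x h + tmul σ y h := by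
  have : preTmul σ (x + y) h = preTmul σ x h + preTmul σ y h := TensorProduct.add_tmul _ _ _
  rw [tmul, this]; exact UniformSpace.Completion.coe_add _ _

lemma tmul_smul_left (c : ℂ) (x : E) (h : H) : tmul σ (c • x) h = c • tmul σ x h := by
  have : preTmul σ (c • x) h = c • preTmul σ x h := rfl
  rw [tmul, this]; exact UniformSpace.Completion.coe_smul _ _

lemma norm_tmul_le (x : E) (h : H) : ‖tmul σ x h‖ ≤ ‖x‖ * ‖h‖ := by
  have h1 : ‖tmul σ x h‖ ^ 2 ≤ (‖x‖ * ‖h‖) ^ 2 := by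
    rw [← inner_self_eq_norm_sq (𝕜 := ℂ), inner_tmul]
    calc _ ≤ ‖⟪h, σ (ip x x) h⟫_ℂ‖ := RCLike.re_le_norm _
      _ ≤ ‖h‖ * (‖(ip x x : A)‖ * ‖h‖) := by
        refine (norm_inner_le_norm _ _).trans ?_
        gcongr
        refine ((σ (ip x x)).le_opNorm h).trans ?_
        gcongr
        exact NonUnitalStarAlgHom.norm_apply_le σ _
      _ = _ := by rw [← norm_sq_eq]; ring
  exact le_of_sq_le_sq h1 (by positivity)

/-- Two bounded operators on `E ⊗_σ H` agree if they agree on elementary tensors. -/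
lemma clm_ext {F : Type*} [NormedAddCommGroup F] [NormedSpace ℂ F]
    {S T : InteriorTensor E σ →L[ℂ] F} (h : ∀ x k, S (tmul σ x k) = T (tmul σ x k)) : S = T := by
  ext v
  refine UniformSpace.Completion.induction_on
    (p := fun v : UniformSpace.Completion (PreTensor E σ) => S v = T v) v
    (isClosed_eq S.continuous T.continuous) fun v => ?_
  let ι : E ⊗[ℂ] H → InteriorTensor E σ := fun v =>
    ((show PreTensor E σ from v : PreTensor E σ) : UniformSpace.Completion (PreTensor E σ))
  have h0 : ι 0 = 0 := UniformSpace.Completion.coe_zero (α := PreTensor E σ)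
  have hadd : ∀ v w, ι (v + w) = ι v + ι w := fun v w =>
    UniformSpace.Completion.coe_add (α := PreTensor E σ) v w
  have : ∀ v : E ⊗[ℂ] H, S (ι v) = T (ι v) := by
    intro v
    induction v with
    | zero => rw [h0, map_zero, map_zero]
    | add v w hv hw => rw [hadd, map_add, map_add, hv, hw]
    | tmul x k => exact h x k
  exact this v

/-- The creation map `h ↦ x ⊗ h` from `H` to `E ⊗_σ H`. -/
def tmulL (x : E) : H →L[ℂ] InteriorTensor E σ :=
  LinearMap.mkContinuous
    { toFun := fun h => tmul σ x h
      map_add' := tmul_add_right σ x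
      map_smul' := fun c h => tmul_smul_right σ x c h } ‖x‖ (norm_tmul_le σ x)

@[simp] lemma tmulL_apply (x : E) (h : H) : tmulL σ x h = tmul σ x h := rfl

end

end Interior

section Correspondence

/-- A W⋆-correspondence over the W⋆-algebra `A`: a selfdual right Hilbert module `E` over `A` with
a unital normal `*`-homomorphism `act` from `A` to the adjointable operators of `E`. Normality is
expressed through the functionals: an increasing net `Tᵢ` of adjointable operators has supremum `T`
if and only if `⟨x, Tᵢ x⟩` has supremum `⟨x, T x⟩` in `A` for every `x`. -/
class WStarCorrespondence (A E : Type*) [CStarAlgebra A] [PartialOrder A] [StarOrderedRing A]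
    [WStarAlgebra A] [NormedAddCommGroup E] [NormedSpace ℂ E] [CompleteSpace E] [Module Aᵐᵒᵖ E]
    extends RightCStarModule A E where
  selfDual : ∀ f : E →L[ℂ] A, (∀ (x : E) (a : A), f (op a • x) = f x * a) →
    ∃ y, ∀ x, f x = ip y x
  act : A →ₐ[ℂ] (E →L[ℂ] E)
  ip_act_left : ∀ (a : A) (x y : E), ip (act a x) y = ip x (act (star a) y)
  act_normal : ∀ x : E, ScottContinuous fun a : A => ip x (act a x)

open WStarCorrespondence

variable {A E H : Type*} [CStarAlgebra A] [PartialOrder A] [StarOrderedRing A] [WStarAlgebra A]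
  [NormedAddCommGroup E] [NormedSpace ℂ E] [CompleteSpace E] [Module Aᵐᵒᵖ E]
  [WStarCorrespondence A E]
  [NormedAddCommGroup H] [InnerProductSpace ℂ H] [CompleteSpace H]

lemma ip_ext {x y : E} (h : ∀ z : E, (ip z x : A) = ip z y) : x = y := by
  have h1 : (ip (x - y) (x - y) : A) = 0 := by
    have h2 := ip_add_right (A := A) (x - y) (x - y) y
    rw [sub_add_cancel, h] at h2
    exact left_eq_add.1 (by rw [add_comm]; exact h2)
  have h2 := norm_sq_eq (A := A) (x - y)
  rw [h1, norm_zero] at h2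
  exact sub_eq_zero.1 (norm_eq_zero.1 (pow_eq_zero_iff (two_ne_zero) |>.1 h2))

/-- `T` and `S` are adjoint operators on `E`: `⟨T x, y⟩ = ⟨x, S y⟩`. -/
def IsAdjointPair (A : Type*) {E : Type*} [CStarAlgebra A] [PartialOrder A] [StarOrderedRing A]
    [NormedAddCommGroup E] [NormedSpace ℂ E] [CompleteSpace E] [Module Aᵐᵒᵖ E]
    [RightCStarModule A E] (T S : E →L[ℂ] E) : Prop :=
  ∀ x y : E, (ip (T x) y : A) = ip x (S y)

lemma IsAdjointPair.isModuleMap {T S : E →L[ℂ] E} (h : IsAdjointPair A T S) : IsModuleMap A T := by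
  intro x a
  apply ip_ext (A := A)
  intro z
  have h' : ∀ z y : E, (ip z (T y) : A) = ip (S z) y := fun z y => by
    rw [← star_ip, h, star_ip]
  rw [h', ip_op_smul_right, ip_op_smul_right, h']

/-- The unitary elements of the algebra of adjointable operators of `E`. -/
structure UnitaryOp (A E : Type*) [CStarAlgebra A] [PartialOrder A] [StarOrderedRing A]
    [NormedAddCommGroup E] [NormedSpace ℂ E] [CompleteSpace E] [Module Aᵐᵒᵖ E]
    [RightCStarModule A E] where
  val : E →L[ℂ] E
  adj : E →L[ℂ] E
  isAdjointPair : IsAdjointPair A val adj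
  val_adj : val ∘L adj = ContinuousLinearMap.id ℂ E
  adj_val : adj ∘L val = ContinuousLinearMap.id ℂ E

lemma act_isAdjointPair (a : A) : IsAdjointPair A (act a : E →L[ℂ] E) (act (star a)) :=
  fun x y => ip_act_left a x y

variable (E) in
/-- The representation `a ↦ φ(a) ⊗ I_H` of `A` on `E ⊗_σ H`. -/
def inducedRep (σ : A →⋆ₐ[ℂ] (H →L[ℂ] H)) :
    A →⋆ₐ[ℂ] (InteriorTensor E σ →L[ℂ] InteriorTensor E σ) where
  toFun a := tensorId σ (act a) (act_isAdjointPair a).isModuleMap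
  map_one' := clm_ext σ fun x k => by simp
  map_mul' a b := clm_ext σ fun x k => by simp [mul_apply_eq_comp]
  map_zero' := clm_ext σ fun x k => by
    have : tmul σ (0 : E) k = 0 := by simpa using tmul_smul_left σ 0 (0 : E) k
    simp [this]
  map_add' a b := clm_ext σ fun x k => by simp [tmul_add_left]
  commutes' c := clm_ext σ fun x k => by
    simp [Algebra.algebraMap_eq_smul_one, tmul_smul_left]
  map_star' a := clm_ext σ fun x k => by
    rw [ContinuousLinearMap.star_eq_adjoint, tensorId_tmul]
    refine ext_inner_right ℂ fun w => ?_
    rw [ContinuousLinearMap.adjoint_inner_left]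
    have : (innerSL ℂ (tmul σ x k)) ∘L (tensorId σ (act a) (act_isAdjointPair a).isModuleMap)
        = innerSL ℂ (tmul σ (act (star a) x) k) := clm_ext σ fun y l => by
      simp only [ContinuousLinearMap.comp_apply, tensorId_tmul, innerSL_apply_apply, inner_tmul]
      rw [ip_act_left, star_star]
    exact (congrArg (fun f => f w) this).symm

@[simp] lemma inducedRep_tmul (σ : A →⋆ₐ[ℂ] (H →L[ℂ] H)) (a : A) (x : E) (h : H) :
    inducedRep E σ a (tmul σ x h) = tmul σ (act a x) h :=
  tensorId_tmul σ _ _ x h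

/-- The operator `u ⊗ I_H` on `E ⊗_σ H`. -/
def UnitaryOp.tensorId (σ : A →⋆ₐ[ℂ] (H →L[ℂ] H)) (u : UnitaryOp A E) :
    InteriorTensor E σ →L[ℂ] InteriorTensor E σ :=
  Hardy.tensorId σ u.val u.isAdjointPair.isModuleMap

end Correspondence

section Ultraweak

/-- The ultraweak topology on `B(K)`, generated by the functionals
`T ↦ ∑ₙ ⟨ξₙ, T ζₙ⟩` with `(ξₙ)`, `(ζₙ)` square summable. -/
@[reducible] def ultraweak (K : Type*) [NormedAddCommGroup K] [InnerProductSpace ℂ K] :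
    TopologicalSpace (K →L[ℂ] K) :=
  ⨅ (ξ : lp (fun _ : ℕ => K) 2) (ζ : lp (fun _ : ℕ => K) 2),
    TopologicalSpace.induced (fun T : K →L[ℂ] K => ∑' n, ⟪ξ n, T (ζ n)⟫_ℂ) inferInstance

/-- The norm of a square matrix of bounded operators on `K`, as an operator on `Kⁿ`. -/
def matrixNorm {K : Type*} [NormedAddCommGroup K] [InnerProductSpace ℂ K] [CompleteSpace K]
    {n : ℕ} (X : Matrix (Fin n) (Fin n) (K →L[ℂ] K)) : ℝ :=
  ‖CStarMatrix.ofMatrix X‖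

end Ultraweak

section Fock

/-- A Hilbert space with a unital `*`-representation of `A`. -/
structure HilbertRep (A : Type v) [CStarAlgebra A] where
  carrier : Type u
  [normedAddCommGroup : NormedAddCommGroup carrier]
  [innerProductSpace : InnerProductSpace ℂ carrier]
  [completeSpace : CompleteSpace carrier]
  rep : A →⋆ₐ[ℂ] (carrier →L[ℂ] carrier)

attribute [instance] HilbertRep.normedAddCommGroup HilbertRep.innerProductSpace
  HilbertRep.completeSpace

variable {A : Type v} {E : Type u} [CStarAlgebra A] [PartialOrder A] [StarOrderedRing A]
  [WStarAlgebra A] [NormedAddCommGroup E] [NormedSpace ℂ E] [CompleteSpace E] [Module Aᵐᵒᵖ E]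
  [WStarCorrespondence A E]

variable (E)

/-- The Hilbert space `E^{⊗n} ⊗_π H₀`, as `E ⊗ (E ⊗ ⋯ (E ⊗_π H₀))`, with the left action of `A`. -/
def tensorPower (π : HilbertRep.{u} A) : ℕ → HilbertRep.{u} A
  | 0 => π
  | n + 1 => ⟨InteriorTensor E (tensorPower π n).rep, inducedRep E (tensorPower π n).rep⟩

/-- The Hilbert space `ℱ(E) ⊗_π H₀ = ⨁ₙ E^{⊗n} ⊗_π H₀`. -/
abbrev FockSpace (π : HilbertRep.{u} A) : Type u :=
  lp (fun n => (tensorPower E π n).carrier) 2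

/-- The diagonal operator `φ_∞(a)`. -/
def diagonal (π : HilbertRep.{u} A) (a : A) : FockSpace E π →L[ℂ] FockSpace E π :=
  lp.mapCLM 2 (fun n => (tensorPower E π n).rep a) (norm_nonneg a)
    (fun n => NonUnitalStarAlgHom.norm_apply_le (tensorPower E π n).rep a)

/-- The unilateral shift of a graded Hilbert space by one degree. -/
def shift (G : ℕ → Type*) [∀ n, NormedAddCommGroup (G n)] [∀ n, NormedSpace ℂ (G n)] :
    lp (fun n => G (n + 1)) 2 →L[ℂ] lp G 2 :=
  LinearMap.mkContinuous
    { toFun := fun ξ => ⟨fun n => Nat.casesOn n 0 (fun m => ξ m), by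
        refine memℓp_gen ((summable_nat_add_iff 1).1 ?_)
        exact (lp.memℓp ξ).summable (by norm_num)⟩
      map_add' := fun ξ ζ => by
        ext n
        cases n
        · exact (add_zero _).symm
        · rfl
      map_smul' := fun c ξ => by ext n; cases n <;> simp } 1 (fun ξ => by
    rw [one_mul]
    refine lp.norm_le_of_tsum_le (by norm_num) (norm_nonneg _) ?_
    rw [lp.norm_rpow_eq_tsum (by norm_num)]
    rw [Summable.tsum_eq_zero_add]
    · simp
    · refine (summable_nat_add_iff 1).1 ?_
      exact (lp.memℓp ξ).summable (by norm_num))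

/-- The creation operator `T_x`, with `T_x(ξ₀, ξ₁, …) = (0, x ⊗ ξ₀, x ⊗ ξ₁, …)`. -/
def creation (π : HilbertRep.{u} A) (x : E) : FockSpace E π →L[ℂ] FockSpace E π :=
  shift (fun n => (tensorPower E π n).carrier) ∘L
    lp.mapCLM (E := fun n => (tensorPower E π n).carrier)
      (F := fun n => (tensorPower E π (n + 1)).carrier) 2
      (fun n => tmulL (tensorPower E π n).rep x) (norm_nonneg x)
      (fun _ => LinearMap.mkContinuous_norm_le _ (norm_nonneg x) _)

lemma diagonal_apply (π : HilbertRep.{u} A) (a : A) (ξ : FockSpace E π) (n : ℕ) :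
    diagonal E π a ξ n = (tensorPower E π n).rep a (ξ n) := rfl

lemma creation_apply_zero (π : HilbertRep.{u} A) (x : E) (ξ : FockSpace E π) :
    creation E π x ξ 0 = 0 := rfl

lemma creation_apply_succ (π : HilbertRep.{u} A) (x : E) (ξ : FockSpace E π) (n : ℕ) :
    creation E π x ξ (n + 1) = tmul (tensorPower E π n).rep x (ξ n) := rfl

/-- The Hardy algebra `H^∞(E)`: the ultraweakly closed algebra generated by the operators `φ_∞(a)`
and `T_x`. It is realized on `ℱ(E) ⊗_π H₀`: if `π` is normal and faithful, then `T ↦ T ⊗ I` is a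
faithful normal representation of the W⋆-algebra of adjointable operators on `ℱ(E)`. -/
def hardyAlgebra (π : HilbertRep.{u} A) : Subalgebra ℂ (FockSpace E π →L[ℂ] FockSpace E π) :=
  sInf {S | Set.range (diagonal E π) ⊆ S ∧ Set.range (creation E π) ⊆ S ∧
    @IsClosed _ (ultraweak (FockSpace E π)) (S : Set (FockSpace E π →L[ℂ] FockSpace E π))}

lemma diagonal_mem (π : HilbertRep.{u} A) (a : A) : diagonal E π a ∈ hardyAlgebra E π :=
  Algebra.mem_sInf.2 fun _ hS => hS.1 ⟨a, rfl⟩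

lemma creation_mem (π : HilbertRep.{u} A) (x : E) : creation E π x ∈ hardyAlgebra E π :=
  Algebra.mem_sInf.2 fun _ hS => hS.2.1 ⟨x, rfl⟩

/-- The `w*`-topology of `H^∞(E)`. -/
@[reducible] def hardyTopology (π : HilbertRep.{u} A) : TopologicalSpace (hardyAlgebra E π) :=
  TopologicalSpace.induced Subtype.val (ultraweak (FockSpace E π))

/-- `Aut(H^∞(E))`: the completely isometric, `w*`-homeomorphic automorphisms of `H^∞(E)` that fix
`φ_∞(A)` elementwise. -/
structure HardyAut (π : HilbertRep.{u} A) where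
  toAlgEquiv : hardyAlgebra E π ≃ₐ[ℂ] hardyAlgebra E π
  completely_isometric : ∀ (n : ℕ) (X : Matrix (Fin n) (Fin n) (hardyAlgebra E π)),
    matrixNorm (X.map fun x => (toAlgEquiv x : FockSpace E π →L[ℂ] FockSpace E π))
      = matrixNorm (X.map fun x => (x : FockSpace E π →L[ℂ] FockSpace E π))
  continuous_toFun : @Continuous _ _ (hardyTopology E π) (hardyTopology E π) toAlgEquiv
  continuous_invFun : @Continuous _ _ (hardyTopology E π) (hardyTopology E π) toAlgEquiv.symm
  fix_diagonal : ∀ a : A, toAlgEquiv ⟨diagonal E π a, diagonal_mem E π a⟩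
    = ⟨diagonal E π a, diagonal_mem E π a⟩

end Fock

section Disc

variable {A : Type v} (E : Type u) {H : Type w}
  [CStarAlgebra A] [PartialOrder A] [StarOrderedRing A] [WStarAlgebra A]
  [NormedAddCommGroup E] [NormedSpace ℂ E] [CompleteSpace E] [Module Aᵐᵒᵖ E]
  [WStarCorrespondence A E]
  [NormedAddCommGroup H] [InnerProductSpace ℂ H] [CompleteSpace H]
  (σ : A →⋆ₐ[ℂ] (H →L[ℂ] H))

/-- The intertwining space `(E^σ)^*`: the operators `η*` from `E ⊗_σ H` to `H` with
`η* (φ(a) ⊗ I_H) = σ(a) η*` for all `a`. -/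
def intertwiners : Submodule ℂ (InteriorTensor E σ →L[ℂ] H) where
  carrier := {T | ∀ a, T ∘L inducedRep E σ a = σ a ∘L T}
  add_mem' hS hT a := by
    rw [ContinuousLinearMap.add_comp, ContinuousLinearMap.comp_add, hS a, hT a]
  zero_mem' a := by rw [ContinuousLinearMap.zero_comp, ContinuousLinearMap.comp_zero]
  smul_mem' c T hT a := by
    rw [ContinuousLinearMap.smul_comp, ContinuousLinearMap.comp_smul, hT a]

/-- The space `E^σ`: the operators `η` from `H` to `E ⊗_σ H` with
`η σ(a) = (φ(a) ⊗ I_H) η` for all `a`. -/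
def dualCorrespondence : Submodule ℂ (H →L[ℂ] InteriorTensor E σ) where
  carrier := {T | ∀ a, T ∘L σ a = inducedRep E σ a ∘L T}
  add_mem' hS hT a := by
    rw [ContinuousLinearMap.add_comp, ContinuousLinearMap.comp_add, hS a, hT a]
  zero_mem' a := by rw [ContinuousLinearMap.zero_comp, ContinuousLinearMap.comp_zero]
  smul_mem' c T hT a := by
    rw [ContinuousLinearMap.smul_comp, ContinuousLinearMap.comp_smul, hT a]

/-- The open unit disc `𝔻((E^σ)^*)`. -/
def disc : Set (intertwiners E σ) := {η | ‖η‖ < 1}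

/-- `Aut(𝔻((E^σ)^*))`: the biholomorphic self-maps of the disc (the values outside the disc are
irrelevant). -/
structure DiscAut where
  toFun : intertwiners E σ → intertwiners E σ
  invFun : intertwiners E σ → intertwiners E σ
  mapsTo_toFun : Set.MapsTo toFun (disc E σ) (disc E σ)
  mapsTo_invFun : Set.MapsTo invFun (disc E σ) (disc E σ)
  leftInvOn : Set.LeftInvOn invFun toFun (disc E σ)
  rightInvOn : Set.RightInvOn invFun toFun (disc E σ)
  differentiableOn_toFun : DifferentiableOn ℂ toFun (disc E σ)
  differentiableOn_invFun : DifferentiableOn ℂ invFun (disc E σ)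

variable {E}

/-- `ρ` is the representation `σ × η*` of `H^∞(E)`: the ultraweakly continuous, completely
contractive representation with `φ_∞(a) ↦ σ(a)` and `T_x ↦ η*(x ⊗ ·)`. -/
structure IsIntegratedForm (π : HilbertRep.{u} A) (η : intertwiners E σ)
    (ρ : hardyAlgebra E π →ₐ[ℂ] (H →L[ℂ] H)) : Prop where
  continuous : @Continuous _ _ (hardyTopology E π) (ultraweak H) ρ
  completely_contractive : ∀ (n : ℕ) (X : Matrix (Fin n) (Fin n) (hardyAlgebra E π)),
    matrixNorm (X.map ρ) ≤ matrixNorm (X.map fun x => (x : FockSpace E π →L[ℂ] FockSpace E π))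
  map_diagonal : ∀ a : A, ρ ⟨diagonal E π a, diagonal_mem E π a⟩ = σ a
  map_creation : ∀ (x : E) (h : H), ρ ⟨creation E π x, creation_mem E π x⟩ h = η.1 (tmul σ x h)

variable {σ}

/-- `g` implements `α`: the function `X̂(η*) = (σ × η*)(X)` satisfies
`(α X)^(η*) = X̂(g(η*))` for all `X` in `H^∞(E)` and all `η*` in the disc. -/
def Implements {π : HilbertRep.{u} A} (g : DiscAut E σ) (α : HardyAut E π) : Prop :=
  ∀ η ∈ disc E σ, ∀ ρ₁ ρ₂ : hardyAlgebra E π →ₐ[ℂ] (H →L[ℂ] H),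
    IsIntegratedForm σ π η ρ₁ → IsIntegratedForm σ π (g.toFun η) ρ₂ →
      ∀ X, ρ₁ (α.toAlgEquiv X) = ρ₂ X

end Disc

section Matrix

variable {A : Type v} {E : Type u} {H : Type w}
  [CStarAlgebra A] [PartialOrder A] [StarOrderedRing A] [WStarAlgebra A]
  [NormedAddCommGroup E] [NormedSpace ℂ E] [CompleteSpace E] [Module Aᵐᵒᵖ E]
  [WStarCorrespondence A E]
  [NormedAddCommGroup H] [InnerProductSpace ℂ H] [CompleteSpace H]

/-- The defect operator `Δ_γ = (I - γ*γ)^{1/2}`. With `γ*` in place of `γ` it is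
`Δ_{γ*} = (I - γγ*)^{1/2}`. -/
def defect {K L : Type*} [NormedAddCommGroup K] [InnerProductSpace ℂ K] [CompleteSpace K]
    [NormedAddCommGroup L] [InnerProductSpace ℂ L] [CompleteSpace L] (γ : K →L[ℂ] L) :
    K →L[ℂ] K :=
  CFC.sqrt (1 - ContinuousLinearMap.adjoint γ ∘L γ)

open ContinuousLinearMap (adjoint)

/-- The Möbius transformation
`g_γ(η*) = Δ_γ (I - η*γ)⁻¹ (γ* - η*) Δ_{γ*}⁻¹`. -/
def mobius {K L : Type*} [NormedAddCommGroup K] [InnerProductSpace ℂ K] [CompleteSpace K]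
    [NormedAddCommGroup L] [InnerProductSpace ℂ L] [CompleteSpace L] (γ : K →L[ℂ] L)
    (η : L →L[ℂ] K) : L →L[ℂ] K :=
  defect γ ∘L Ring.inverse (1 - η ∘L γ) ∘L (adjoint γ - η) ∘L Ring.inverse (defect (adjoint γ))

/-- A `1 × 2` block matrix `[a b]` of operators with `a : H → H` and `b : L → H`. -/
@[ext] structure Row (H L : Type*) [NormedAddCommGroup H] [NormedSpace ℂ H]
    [NormedAddCommGroup L] [NormedSpace ℂ L] where
  fst : H →L[ℂ] H
  snd : L →L[ℂ] H

/-- A `2 × 2` block matrix of operators on `H ⊕ L`. -/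
@[ext] structure BlockMatrix (H L : Type*) [NormedAddCommGroup H] [NormedSpace ℂ H]
    [NormedAddCommGroup L] [NormedSpace ℂ L] where
  a₁₁ : H →L[ℂ] H
  a₁₂ : L →L[ℂ] H
  a₂₁ : H →L[ℂ] L
  a₂₂ : L →L[ℂ] L

/-- Right multiplication of a row by a block matrix. -/
def Row.mul {H L : Type*} [NormedAddCommGroup H] [NormedSpace ℂ H]
    [NormedAddCommGroup L] [NormedSpace ℂ L] (r : Row H L) (M : BlockMatrix H L) : Row H L where
  fst := r.fst ∘L M.a₁₁ + r.snd ∘L M.a₂₁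
  snd := r.fst ∘L M.a₁₂ + r.snd ∘L M.a₂₂

/-- The block matrix with rows `Δ_γ⁻¹, γ*Δ_{γ*}⁻¹ v` and `-γΔ_γ⁻¹, -Δ_{γ*}⁻¹ v`. -/
def mobiusMatrix {K L : Type*} [NormedAddCommGroup K] [InnerProductSpace ℂ K] [CompleteSpace K]
    [NormedAddCommGroup L] [InnerProductSpace ℂ L] [CompleteSpace L] (γ : K →L[ℂ] L)
    (v : L →L[ℂ] L) : BlockMatrix K L where
  a₁₁ := Ring.inverse (defect γ)
  a₁₂ := adjoint γ ∘L Ring.inverse (defect (adjoint γ)) ∘L v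
  a₂₁ := -(γ ∘L Ring.inverse (defect γ))
  a₂₂ := -(Ring.inverse (defect (adjoint γ)) ∘L v)

/-- The commutant `σ(A)'`. -/
abbrev commutant (σ : A →⋆ₐ[ℂ] (H →L[ℂ] H)) : Subalgebra ℂ (H →L[ℂ] H) :=
  Subalgebra.centralizer ℂ (Set.range σ)

variable (E) in
/-- The pairs `(U, η*)` with `U` invertible in `σ(A)'` and `η*` in `(E^σ)^*`. -/
structure Coordinates (σ : A →⋆ₐ[ℂ] (H →L[ℂ] H)) where
  U : (commutant σ)ˣ
  η : intertwiners E σ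

/-- The pair `(U, η*)` as a row `[U η*]`. -/
def Coordinates.row {σ : A →⋆ₐ[ℂ] (H →L[ℂ] H)} (p : Coordinates E σ) :
    Row H (InteriorTensor E σ) :=
  ⟨(p.U : commutant σ), p.η⟩

/-- `(U₁, η₁*) ∼ (U₂, η₂*)` if `(C U₁, C η₁*) = (U₂, η₂*)` for an invertible `C` in `σ(A)'`. -/
instance Coordinates.setoid (σ : A →⋆ₐ[ℂ] (H →L[ℂ] H)) : Setoid (Coordinates E σ) where
  r p q := ∃ C : (commutant σ)ˣ, C * p.U = q.U ∧
    ((C : commutant σ) : H →L[ℂ] H) ∘L (p.η : InteriorTensor E σ →L[ℂ] H) = q.η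
  iseqv :=
    { refl := fun p => ⟨1, one_mul _, by ext v; rfl⟩
      symm := by
        rintro p q ⟨C, h1, h2⟩
        refine ⟨C⁻¹, by rw [← h1, inv_mul_cancel_left], ?_⟩
        have : (((C⁻¹ : (commutant σ)ˣ) : commutant σ) : H →L[ℂ] H)
            * ((C : commutant σ) : H →L[ℂ] H) = 1 := by
          exact congrArg Subtype.val C.inv_mul
        rw [← h2, ← ContinuousLinearMap.comp_assoc]
        ext v
        exact congrArg (fun f => f ((p.η : InteriorTensor E σ →L[ℂ] H) v)) this
      trans := by
        rintro p q r ⟨C, h1, h2⟩ ⟨D, h3, h4⟩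
        refine ⟨D * C, by rw [mul_assoc, h1, h3], ?_⟩
        rw [← h4, ← h2]
        ext v
        rfl }

variable (E) in
/-- The set `ℙ` of classes of pairs. -/
abbrev ProjLine (σ : A →⋆ₐ[ℂ] (H →L[ℂ] H)) : Type _ := Quotient (Coordinates.setoid (E := E) σ)

/-- The pair `(I_H, η*)`. -/
def affine {σ : A →⋆ₐ[ℂ] (H →L[ℂ] H)} (η : intertwiners E σ) : Coordinates E σ := ⟨1, η⟩

/-- The class `[U η*]` in `ℙ`. -/
abbrev Coordinates.toProj {σ : A →⋆ₐ[ℂ] (H →L[ℂ] H)} (p : Coordinates E σ) : ProjLine E σ :=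
  Quotient.mk _ p

/-- The row `r` is a pair `(U, η*)` with `U` invertible in `σ(A)'` and `η*` in `(E^σ)^*`, and its
class in `ℙ` is `P`. -/
def Row.Represents {σ : A →⋆ₐ[ℂ] (H →L[ℂ] H)} (r : Row H (InteriorTensor E σ))
    (P : ProjLine E σ) : Prop :=
  ∃ q : Coordinates E σ, q.row = r ∧ q.toProj = P

end Matrix

end Hardy

end

open Hardy

/-!
Put `C = (I - η*γ) Δ_γ⁻¹`. Cancelling `Δ_γ⁻¹ Δ_γ` and `(I - η*γ)(I - η*γ)⁻¹` in `C g_γ(η*)` gives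
`[I η*] T = C [I g(η*)]`. Since `γ` and `η*` are intertwiners, `C` is an invertible element of the
commutant, so both rows have the same class in `ℙ`. The class is independent of the representative
because left multiplication of a row by the commutant commutes with right multiplication by `T`.
-/

namespace Hardy

open ContinuousLinearMap (adjoint)

section Centralizer

variable {R B : Type*} [CommSemiring R] [Semiring B] [Algebra R B] {s : Set B}

lemma ringInverse_mem_centralizer {b : B} (hb : b ∈ Subalgebra.centralizer R s) :
    Ring.inverse b ∈ Subalgebra.centralizer R s := by
  by_cases hu : IsUnit b
  · obtain ⟨c, rfl⟩ := hu
    rw [Ring.inverse_unit]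
    exact fun x hx => Commute.units_inv_right (hb x hx)
  · rw [Ring.inverse_non_unit b hu]
    exact zero_mem _

lemma isUnit_mk_centralizer {b : B} (hb : b ∈ Subalgebra.centralizer R s) (hu : IsUnit b) :
    IsUnit (⟨b, hb⟩ : Subalgebra.centralizer R s) :=
  ⟨⟨⟨b, hb⟩, ⟨_, ringInverse_mem_centralizer hb⟩, Subtype.ext (Ring.mul_inverse_cancel b hu),
    Subtype.ext (Ring.inverse_mul_cancel b hu)⟩, rfl⟩

end Centralizer

section Row

variable {K L : Type*} [NormedAddCommGroup K] [NormedSpace ℂ K]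
  [NormedAddCommGroup L] [NormedSpace ℂ L]

/-- Left multiplication of a row by an operator: `C [a b] = [Ca Cb]`. -/
instance Row.instSMul : SMul (K →L[ℂ] K) (Row K L) where
  smul C r := ⟨C ∘L r.fst, C ∘L r.snd⟩

lemma Row.smul_mk (C a : K →L[ℂ] K) (b : L →L[ℂ] K) :
    C • Row.mk a b = ⟨C ∘L a, C ∘L b⟩ := rfl

lemma Row.smul_mul (C : K →L[ℂ] K) (r : Row K L) (M : BlockMatrix K L) :
    (C • r).mul M = C • r.mul M := by
  ext x <;> exact (C.map_add _ _).symm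

end Row

lemma isUnit_one_sub_comp {𝕜 K L : Type*} [NontriviallyNormedField 𝕜]
    [NormedAddCommGroup K] [NormedSpace 𝕜 K] [CompleteSpace K]
    [NormedAddCommGroup L] [NormedSpace 𝕜 L]
    {γ : K →L[𝕜] L} {η : L →L[𝕜] K} (hγ : ‖γ‖ < 1) (hη : ‖η‖ ≤ 1) : IsUnit (1 - η ∘L γ) :=
  isUnit_one_sub_of_norm_lt_one <| (η.opNorm_comp_le γ).trans_lt <|
    mul_lt_one_of_nonneg_of_lt_one_right hη (norm_nonneg γ) hγ

section Mobius

variable {K L : Type*} [NormedAddCommGroup K] [InnerProductSpace ℂ K] [CompleteSpace K]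
  [NormedAddCommGroup L] [InnerProductSpace ℂ L] [CompleteSpace L]
  {γ : K →L[ℂ] L} {η : L →L[ℂ] K}

lemma isUnit_defect (hγ : ‖γ‖ < 1) : IsUnit (defect γ) := by
  have norm_lt : ‖adjoint γ ∘L γ‖ < 1 := by
    rw [ContinuousLinearMap.norm_adjoint_comp_self]
    exact mul_lt_one_of_nonneg_of_lt_one_left (norm_nonneg γ) hγ hγ.le
  have nonneg : 0 ≤ adjoint γ ∘L γ :=
    (ContinuousLinearMap.nonneg_iff_isPositive _).2 γ.isPositive_adjoint_comp_self
  have le_one : adjoint γ ∘L γ ≤ 1 :=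
    (CStarAlgebra.norm_le_one_iff_of_nonneg _ nonneg).1 norm_lt.le
  rw [defect, CFC.isUnit_sqrt_iff _ (sub_nonneg.2 le_one)]
  exact isUnit_one_sub_of_norm_lt_one norm_lt

lemma commute_defect {T : K →L[ℂ] K} (hT : Commute (adjoint γ ∘L γ) T) :
    Commute (defect γ) T :=
  ((Commute.one_left T).sub_left hT).cfcₙ_nnreal NNReal.sqrt

/-- The automorphy factor `(I - ηγ) Δ_γ⁻¹` of the Möbius transformation `g_γ`, by which the row
`[I η] T` differs from `[I g_γ(η)v]` in `row_mul_mobiusMatrix`. -/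
noncomputable def automorphyFactor (γ : K →L[ℂ] L) (η : L →L[ℂ] K) : K →L[ℂ] K :=
  (1 - η ∘L γ) * Ring.inverse (defect γ)

lemma isUnit_automorphyFactor (hΔ : IsUnit (defect γ)) (hη : IsUnit (1 - η ∘L γ)) :
    IsUnit (automorphyFactor γ η) :=
  hη.mul hΔ.ringInverse

lemma automorphyFactor_comp_mobius (hΔ : IsUnit (defect γ)) (hη : IsUnit (1 - η ∘L γ)) :
    automorphyFactor γ η ∘L mobius γ η =
      (adjoint γ - η) ∘L Ring.inverse (defect (adjoint γ)) := by
  have cancel : automorphyFactor γ η * (defect γ * Ring.inverse (1 - η ∘L γ)) = 1 := by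
    rw [automorphyFactor, mul_assoc, Ring.inverse_mul_cancel_left _ _ hΔ,
      Ring.mul_inverse_cancel _ hη]
  calc automorphyFactor γ η ∘L mobius γ η
      = (automorphyFactor γ η * (defect γ * Ring.inverse (1 - η ∘L γ))) ∘L
          (adjoint γ - η) ∘L Ring.inverse (defect (adjoint γ)) := rfl
    _ = (adjoint γ - η) ∘L Ring.inverse (defect (adjoint γ)) := by
      rw [cancel, ContinuousLinearMap.one_def, ContinuousLinearMap.id_comp]

lemma row_mul_mobiusMatrix (hΔ : IsUnit (defect γ)) (hη : IsUnit (1 - η ∘L γ))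
    (v : L →L[ℂ] L) :
    (Row.mk 1 η).mul (mobiusMatrix γ v) =
      automorphyFactor γ η • Row.mk 1 (mobius γ η ∘L v) := by
  rw [Row.smul_mk, ← ContinuousLinearMap.comp_assoc, automorphyFactor_comp_mobius hΔ hη]
  ext x <;> simp [Row.mul, mobiusMatrix, automorphyFactor, sub_eq_add_neg]

end Mobius

lemma mem_commutant_iff {A H : Type*} [CStarAlgebra A] [NormedAddCommGroup H]
    [InnerProductSpace ℂ H] [CompleteSpace H] {σ : A →⋆ₐ[ℂ] (H →L[ℂ] H)} {T : H →L[ℂ] H} :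
    T ∈ commutant σ ↔ ∀ a, Commute T (σ a) := by
  rw [Subalgebra.mem_centralizer_iff, Set.forall_mem_range]
  exact forall_congr' fun a => eq_comm

section ProjLine

variable {A : Type v} {E : Type u} {H : Type w}
  [CStarAlgebra A] [PartialOrder A] [StarOrderedRing A] [WStarAlgebra A]
  [NormedAddCommGroup E] [NormedSpace ℂ E] [CompleteSpace E] [Module Aᵐᵒᵖ E]
  [WStarCorrespondence A E]
  [NormedAddCommGroup H] [InnerProductSpace ℂ H] [CompleteSpace H]
  {σ : A →⋆ₐ[ℂ] (H →L[ℂ] H)}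

lemma adjoint_mem_intertwiners {γ : H →L[ℂ] InteriorTensor E σ}
    (hγ : γ ∈ dualCorrespondence E σ) : adjoint γ ∈ intertwiners E σ := fun a => by
  simpa only [ContinuousLinearMap.adjoint_comp, map_star, ContinuousLinearMap.star_eq_adjoint,
    ContinuousLinearMap.adjoint_adjoint] using (congrArg adjoint (hγ (star a))).symm

lemma comp_mem_commutant {η : InteriorTensor E σ →L[ℂ] H} (hη : η ∈ intertwiners E σ)
    {γ : H →L[ℂ] InteriorTensor E σ} (hγ : γ ∈ dualCorrespondence E σ) :
    η ∘L γ ∈ commutant σ :=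
  mem_commutant_iff.2 fun a =>
    calc (η ∘L γ) ∘L σ a
        = η ∘L inducedRep E σ a ∘L γ := by rw [ContinuousLinearMap.comp_assoc, hγ a]
      _ = σ a ∘L η ∘L γ := by
        rw [← ContinuousLinearMap.comp_assoc, hη a, ContinuousLinearMap.comp_assoc]

lemma comp_mem_intertwiners {C : H →L[ℂ] H} (hC : C ∈ commutant σ)
    {η : InteriorTensor E σ →L[ℂ] H} (hη : η ∈ intertwiners E σ) :
    C ∘L η ∈ intertwiners E σ := fun a =>
  have commute_C : C ∘L σ a = σ a ∘L C := mem_commutant_iff.1 hC a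
  calc (C ∘L η) ∘L inducedRep E σ a
      = C ∘L σ a ∘L η := by rw [ContinuousLinearMap.comp_assoc, hη a]
    _ = σ a ∘L C ∘L η := by
      rw [← ContinuousLinearMap.comp_assoc, commute_C, ContinuousLinearMap.comp_assoc]

lemma defect_mem_commutant {γ : H →L[ℂ] InteriorTensor E σ}
    (hγ : γ ∈ dualCorrespondence E σ) : defect γ ∈ commutant σ :=
  mem_commutant_iff.2 fun a => commute_defect <|
    mem_commutant_iff.1 (comp_mem_commutant (adjoint_mem_intertwiners hγ) hγ) a

lemma automorphyFactor_mem_commutant {γ : H →L[ℂ] InteriorTensor E σ}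
    (hγ : γ ∈ dualCorrespondence E σ) {η : InteriorTensor E σ →L[ℂ] H}
    (hη : η ∈ intertwiners E σ) : automorphyFactor γ η ∈ commutant σ :=
  mul_mem (sub_mem (one_mem _) (comp_mem_commutant hη hγ))
    (ringInverse_mem_centralizer (defect_mem_commutant hγ))

/-- The action `C • (U, η*) = (CU, Cη*)` of the invertible elements of `σ(A)'`, whose orbits are
the points of `ℙ`. -/
noncomputable instance Coordinates.instSMul : SMul (commutant σ)ˣ (Coordinates E σ) where
  smul C p := ⟨C * p.U, _, comp_mem_intertwiners (C : commutant σ).2 p.η.2⟩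

lemma Coordinates.row_smul (C : (commutant σ)ˣ) (p : Coordinates E σ) :
    (C • p).row = ((C : commutant σ) : H →L[ℂ] H) • p.row := rfl

lemma Coordinates.toProj_eq_iff {p q : Coordinates E σ} :
    p.toProj = q.toProj ↔ ∃ C : (commutant σ)ˣ, C • p = q := by
  refine Quotient.eq.trans (exists_congr fun C => ?_)
  obtain ⟨U, η⟩ := q
  exact ⟨fun ⟨hU, hη⟩ => congrArg₂ Coordinates.mk hU (Subtype.ext hη),
    by rintro ⟨⟩; exact ⟨rfl, rfl⟩⟩

lemma Coordinates.toProj_smul (C : (commutant σ)ˣ) (p : Coordinates E σ) :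
    (C • p).toProj = p.toProj :=
  (toProj_eq_iff.2 ⟨C, rfl⟩).symm

lemma Row.Represents.smul {r : Row H (InteriorTensor E σ)} {P : ProjLine E σ}
    (hr : r.Represents P) {C : H →L[ℂ] H} (hC : C ∈ commutant σ) (hu : IsUnit C) :
    (C • r).Represents P := by
  obtain ⟨q, rfl, rfl⟩ := hr
  obtain ⟨D, hD⟩ := isUnit_mk_centralizer hC hu
  refine ⟨D • q, ?_, q.toProj_smul D⟩
  rw [Coordinates.row_smul, hD]

end ProjLine

end Hardy

theorem mainTheorem6_general {A : Type v} {E : Type u} {H : Type w}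
    [CStarAlgebra A] [PartialOrder A] [StarOrderedRing A] [WStarAlgebra A]
    [NormedAddCommGroup E] [NormedSpace ℂ E] [CompleteSpace E] [Module Aᵐᵒᵖ E]
    [WStarCorrespondence A E]
    [NormedAddCommGroup H] [InnerProductSpace ℂ H] [CompleteSpace H]
    {σ : A →⋆ₐ[ℂ] (H →L[ℂ] H)} {γ : dualCorrespondence E σ} (hγ : ‖γ‖ < 1)
    (v : InteriorTensor E σ →L[ℂ] InteriorTensor E σ) {η ξ : intertwiners E σ}
    (hη : IsUnit (1 - (η : InteriorTensor E σ →L[ℂ] H) ∘L (γ : H →L[ℂ] InteriorTensor E σ)))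
    (hξ : (ξ : InteriorTensor E σ →L[ℂ] H)
      = mobius (γ : H →L[ℂ] InteriorTensor E σ) η ∘L v)
    {p : Coordinates E σ} (hp : p.toProj = (affine η).toProj) :
    (p.row.mul (mobiusMatrix γ v)).Represents (affine ξ).toProj := by
  obtain ⟨D, rfl⟩ := Coordinates.toProj_eq_iff.1 hp.symm
  have hΔ := isUnit_defect (γ := (γ : H →L[ℂ] InteriorTensor E σ)) hγ
  have row_eq : (affine η).row.mul (mobiusMatrix γ v) =
      automorphyFactor (γ : H →L[ℂ] InteriorTensor E σ) η • (affine ξ).row := by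
    refine (row_mul_mobiusMatrix hΔ hη v).trans ?_
    rw [← hξ]
    rfl
  rw [Coordinates.row_smul, Row.smul_mul, row_eq]
  have affine_represents : (affine ξ).row.Represents (affine ξ).toProj := ⟨_, rfl, rfl⟩
  exact (affine_represents.smul (automorphyFactor_mem_commutant γ.2 η.2)
    (isUnit_automorphyFactor hΔ hη)).smul (D : commutant σ).2 (D.isUnit.map (commutant σ).val)

theorem mainTheorem6 {A E : Type u} {H : Type w}
    [CStarAlgebra A] [PartialOrder A] [StarOrderedRing A] [WStarAlgebra A]
    [NormedAddCommGroup E] [NormedSpace ℂ E] [CompleteSpace E] [Module Aᵐᵒᵖ E]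
    [WStarCorrespondence A E]
    [NormedAddCommGroup H] [InnerProductSpace ℂ H] [CompleteSpace H]
    (σ : A →⋆ₐ[ℂ] (H →L[ℂ] H)) (hσ : ScottContinuous σ)
    (π : HilbertRep.{u} A) (hπ : ScottContinuous π.rep) (hπ' : Function.Injective π.rep)
    (α : HardyAut E π) (g : DiscAut E σ) (hg : Implements g α)
    (γ : dualCorrespondence E σ) (hγ : ‖γ‖ < 1) (u : UnitaryOp A E)
    (hform : ∀ η ∈ disc E σ, (g.toFun η : InteriorTensor E σ →L[ℂ] H)
      = mobius (γ : H →L[ℂ] InteriorTensor E σ) η ∘L u.tensorId σ)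
    (η : intertwiners E σ) (hη : η ∈ disc E σ) :
    ((affine η).row.mul (mobiusMatrix γ (u.tensorId σ))).Represents (affine (g.toFun η)).toProj ∧
    ∀ p : Coordinates E σ, p.toProj = (affine η).toProj →
      (p.row.mul (mobiusMatrix γ (u.tensorId σ))).Represents (affine (g.toFun η)).toProj :=
  have represents {p : Coordinates E σ} (hp : p.toProj = (affine η).toProj) :=
    mainTheorem6_general hγ (u.tensorId σ) (isUnit_one_sub_comp hγ hη.le) (hform η hη) hp
  ⟨represents rfl, fun _ => represents⟩
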